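/- For a non-negative integer $n$ put $${}_1F_1(-n;\tfrac32;z)=\sum_{m=0}^{n}\frac{(-n)_m}{(3/2)_m}\frac{z^m}{m!},\qquad {}_2F_1(-n,1;\tfrac32;2)=\sum_{m=0}^{n}\frac{(-n)_m(1)_m}{(3/2)_m}\frac{2^m}{m!},$$ where $(a)_m=a(a+1)\cdots(a+m-1)$, and for $\alpha>0$ put $$T_n(\alpha)=\alpha^{3/4}\int_{-\infty}^{\infty}\frac{x e^{-\alpha x^2}}{e^{2\pi x}-1}\,{}_1F_1\left(-n;\tfrac32;2\alpha x^2\right)dx .$$ These integrals converge absolutely. Let $k\ge 0$ be an integer and let $c_k={}_2F_1(-2k,1;\tfrac32;2)$. (i) If $\alpha,\beta>0$ and $\alpha\beta=\pi^2$, then $T_{2k}(\alpha)=T_{2k}(\beta)$. (ii) For $\alpha,\beta>0$ with $\alpha\beta=\pi^2$ one has, "nearly", $$T_{2k}(\alpha)=\frac{c_k}{2}\left(\frac1\alpha+\frac1\beta+\frac{2}{3c_k}\right)^{1/4}.$$ This means the following: $c_k>0$, and, with $\beta=\pi^2/\alpha$, each of the two sides has the form $$\frac{c_k}{2}\,\alpha^{-1/4}+\frac1{12}\,\alpha^{3/4}+O\left(\alpha^{7/4}\right)\quad(\alpha\to0^+)$$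 and the form $$\frac{c_k}{2}\,\beta^{-1/4}+\frac1{12}\,\beta^{3/4}+O\left(\beta^{7/4}\right)\quad(\alpha\to\infty),$$ with implied constants depending only on $k$. That is, the asymptotic expansions of the two sides agree in their first two terms, for $\alpha$ very small and for $\alpha$ very large. (iii) If $\alpha,\beta>0$ and $\alpha\beta=\pi^2$, then $T_{2k+1}(\alpha)=-T_{2k+1}(\beta)$. In particular, for $\alpha=\beta=\pi$, $$\int_{-\infty}^{\infty}\frac{x e^{-\pi x^2}}{e^{2\pi x}-1}\,{}_1F_1\left(-2k-1;\tfrac32;2\pi x^2\right)dx=0 .$$ -/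

import Mathlib

open Filter Asymptotics MeasureTheory
open scoped Topology

noncomputable section

/-- Kummer's confluent hypergeometric function `₁F₁(a; c; z) = ∑ (a)_n / (c)_n * z ^ n / n!`
with real parameters and argument. The series converges for all `z` as soon as `c` is not a
non-positive integer; only `c = 3/2` is used. -/
def kummerF (a c z : ℝ) : ℝ :=
  ∑' n : ℕ, (ascPochhammer ℝ n).eval a / (ascPochhammer ℝ n).eval c * (z ^ n / (n.factorial : ℝ))

/-- The integrand `x e^{-αx²} / (e^{2πx} - 1) * ₁F₁(a; 3/2; 2αx²)`. -/
def thetaIntegrand (a α x : ℝ) : ℝ :=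
  x * Real.exp (-α * x ^ 2) / (Real.exp (2 * Real.pi * x) - 1) * kummerF a (3 / 2) (2 * α * x ^ 2)

/-- `α^{3/4} ∫_{-∞}^{∞} x e^{-αx²} / (e^{2πx} - 1) * ₁F₁(a; 3/2; 2αx²) dx`. -/
def thetaIntegral (a α : ℝ) : ℝ :=
  α ^ (3 / 4 : ℝ) * ∫ x : ℝ, thetaIntegrand a α x

/-- The constant `₂F₁(-2k, 1; 3/2; 2)`, a terminating series. -/
def nearConst (k : ℕ) : ℝ :=
  ₂F₁ (-2 * (k : ℝ)) (1 : ℝ) (3 / 2 : ℝ) (2 : ℝ)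

/-- The approximating function `(1/2) c (1/α + 1/β + 2/(3c))^{1/4}` with `c = ₂F₁(-2k, 1; 3/2; 2)`. -/
def nearApprox (k : ℕ) (α β : ℝ) : ℝ :=
  1 / 2 * nearConst k * (1 / α + 1 / β + 2 / (3 * nearConst k)) ^ (1 / 4 : ℝ)

/-- The first two terms of the small-`α` expansion,
`(c/2) α^{-1/4} + (1/12) α^{3/4}` with `c = ₂F₁(-2k, 1; 3/2; 2)`. -/
def twoTerms (k : ℕ) (α : ℝ) : ℝ :=
  nearConst k / 2 * α ^ (-(1 / 4) : ℝ) + 1 / 12 * α ^ (3 / 4 : ℝ)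

end

/-!
The polynomial `P_n = ₁F₁(-n; 3/2; ·)` is a multiple of a Laguerre polynomial, and
`x e^{-αx²} P_n(2αx²)` is an odd Hermite function. Write `S_n(α)` for `α^{3/4} ∫ x e^{-αx²} / (e^{2πx} - 1) P_n(2αx²) dx`.

*Functional equations.* All of them come from the case `n = 0` by differentiation. The polynomials
satisfy a ladder relation (`kummerPoly_ladder`) which, after differentiation under the integral sign,
says `α S_n'(α) = (n + 3/2)/2 · S_{n+1}(α) - n/2 · S_{n-1}(α)` (`hasDerivAt_thetaIntegral`). The
operator `α d/dα` anticommutes with `α ↦ π²/α`, so `S_n(π²/α) = (-1)^n S_n(α)` propagates from `n - 1`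
and `n` to `n + 1` (`thetaIntegral_functional`).

For `n = 0` (`integral_boseKernel_mul_exp_functional`), integrate `e^{-αx²}` against two expansions of
the kernel: the geometric series in `e^{-2πx}` on the half-line, and the Mittag-Leffler expansion
`(x/2) coth (πx) = 1/(2π) + (1/π) ∑ x²/(x² + N²)`. The `N`-th term of the second at `α` is, up to a
factor independent of `N`, the `N`-th term of the first at `π²/α`
(`integral_sq_div_sq_add_sq_mul_exp`): `x/(x² + N²)` is the sine transform of `e^{-2πNy}`, and
`x e^{-αx²}` is carried by the sine transform to a function of the same shape.

*Asymptotics.* Folding the integral to the half-line turns the kernel into `2x/(e^{2πx} - 1) + x`. The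
summand `x` gives exactly `c/(2α)`; in the other, `e^{-t} P_{2k}(2t) = 1 + O(t)` and
`∫_0^∞ x/(e^{2πx} - 1) dx = 1/24` give `1/12 + O(α)`. The approximating function is expanded by
`(1 + u)^{1/4} = 1 + u/4 + O(u²)`. The behaviour at infinity follows since both functions are
invariant under `α ↦ π²/α`. Finally `c = ∫_0^1 (2v² - 1)^{2k} dv > 0`.
-/

/-! ### The kernel `x / (e^{2πx} - 1)` -/

/-- The kernel `x / (e^{2πx} - 1)`, with the (harmless) value `0` at the origin. -/
noncomputable def boseKernel (x : ℝ) : ℝ := x / (Real.exp (2 * Real.pi * x) - 1)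

lemma measurable_boseKernel : Measurable boseKernel := by
  unfold boseKernel; fun_prop

lemma boseKernel_neg (x : ℝ) : boseKernel (-x) = x + boseKernel x := by
  unfold boseKernel
  rcases eq_or_ne x 0 with rfl | hx
  · simp
  have h0 : Real.exp (2 * Real.pi * x) ≠ 0 := (Real.exp_pos _).ne'
  have h1 : Real.exp (2 * Real.pi * x) - 1 ≠ 0 := by
    rw [sub_ne_zero, Ne, Real.exp_eq_one_iff]
    positivity
  have h2 : Real.exp (2 * Real.pi * -x) = (Real.exp (2 * Real.pi * x))⁻¹ := by
    rw [← Real.exp_neg]; ring_nf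
  have h3 : (Real.exp (2 * Real.pi * x))⁻¹ - 1 ≠ 0 := by
    rw [sub_ne_zero]; intro h; apply h1; rw [inv_eq_one.mp h, sub_self]
  rw [h2]
  have h4 : (Real.exp (2 * Real.pi * x))⁻¹ - 1
      = -(Real.exp (2 * Real.pi * x) - 1) / Real.exp (2 * Real.pi * x) := by
    field_simp; ring
  rw [h4]
  generalize Real.exp (2 * Real.pi * x) = E at h0 h1
  field_simp
  ring

lemma boseKernel_nonneg (x : ℝ) : 0 ≤ boseKernel x := by
  unfold boseKernel
  rcases le_total 0 x with hx | hx
  · exact div_nonneg hx (sub_nonneg.2 (Real.one_le_exp (by positivity)))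
  · refine div_nonneg_of_nonpos hx (sub_nonpos.2 (Real.exp_le_one_iff.2 ?_))
    exact mul_nonpos_of_nonneg_of_nonpos (by positivity) hx

lemma boseKernel_le_one {x : ℝ} (hx : 0 ≤ x) : boseKernel x ≤ 1 := by
  have h := Real.add_one_le_exp (2 * Real.pi * x)
  have hpi := Real.pi_gt_three
  refine div_le_one_of_le₀ ?_ ?_ <;> nlinarith

lemma boseKernel_le (x : ℝ) : boseKernel x ≤ |x| + 1 := by
  rcases le_total 0 x with hx | hx
  · have := boseKernel_le_one hx
    have := abs_nonneg x
    linarith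
  · have h := boseKernel_neg (-x)
    rw [neg_neg] at h
    have := boseKernel_le_one (x := -x) (by linarith)
    rw [abs_of_nonpos hx]
    linarith

/-- Geometric expansion of the kernel on the positive half-line. -/
lemma hasSum_boseKernel {x : ℝ} (hx : 0 < x) :
    HasSum (fun n : ℕ => x * Real.exp (-(2 * Real.pi * (n + 1)) * x)) (boseKernel x) := by
  have hlt : Real.exp (-(2 * Real.pi * x)) < 1 := Real.exp_lt_one_iff.2 (by
    have := Real.pi_pos
    have : 0 < 2 * Real.pi * x := by positivity
    linarith)
  have h := (hasSum_geometric_of_lt_one (Real.exp_pos _).le hlt).mul_left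
    (x * Real.exp (-(2 * Real.pi * x)))
  have e : x * Real.exp (-(2 * Real.pi * x)) * (1 - Real.exp (-(2 * Real.pi * x)))⁻¹
      = boseKernel x := by
    have h1 : Real.exp (-(2 * Real.pi * x)) = (Real.exp (2 * Real.pi * x))⁻¹ := Real.exp_neg _
    have h2 : 1 < Real.exp (2 * Real.pi * x) := Real.one_lt_exp_iff.2 (by positivity)
    rw [h1, boseKernel]
    have h3 : Real.exp (2 * Real.pi * x) - 1 ≠ 0 := by linarith
    have h0 : Real.exp (2 * Real.pi * x) ≠ 0 := by linarith
    field_simp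
  rw [e] at h
  convert! h using 2 with n
  rw [← Real.exp_nat_mul, mul_assoc x, ← Real.exp_add]
  ring_nf

/-- Mittag-Leffler expansion of the even part `x/2 + x/(e^{2πx} - 1) = (x/2) coth (πx)` of the
kernel, obtained from the expansion of the cotangent at `ix`. -/
lemma hasSum_boseKernel_mittagLeffler {x : ℝ} (hx : x ≠ 0) :
    HasSum (fun n : ℕ => x ^ 2 / (x ^ 2 + (n + 1) ^ 2))
      (Real.pi * (x / 2 + boseKernel x) - 1 / 2) := by
  have hxC : (x : ℂ) ≠ 0 := by exact_mod_cast hx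
  have hz : (x * Complex.I : ℂ) ∈ Complex.integerComplement := by
    rw [Complex.mem_integerComplement_iff]
    rintro ⟨n, hn⟩
    have := congrArg Complex.im hn
    simp at this
    exact hx this.symm
  have hs := (summable_cotTerm hz).hasSum
  have h1 := cot_series_rep' hz
  rw [show (∑' n : ℕ, (1 / (x * Complex.I - (n + 1)) + 1 / (x * Complex.I + (n + 1)) : ℂ))
    = ∑' n, cotTerm (x * Complex.I) n from rfl] at h1
  rw [← h1] at hs
  have hs2 := hs.mul_left (x * Complex.I / 2 : ℂ)
  rw [← Complex.hasSum_ofReal]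
  convert! hs2 using 1
  · funext n
    have hn : (x : ℂ) ^ 2 + (n + 1) ^ 2 ≠ 0 := by
      have : x ^ 2 + ((n : ℝ) + 1) ^ 2 ≠ 0 := by positivity
      exact_mod_cast this
    rw [cotTerm_identity hz]
    have e : ((x * Complex.I + (n + 1)) * (x * Complex.I - (n + 1)) : ℂ)
        = -((x : ℂ) ^ 2 + (n + 1) ^ 2) := by
      linear_combination (x : ℂ) ^ 2 * Complex.I_sq
    rw [e]
    push_cast
    field_simp
    rw [Complex.I_sq]
    ring
  · rw [Complex.cot_pi_eq_exp_ratio]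
    have e : (2 * Real.pi * Complex.I * (x * Complex.I) : ℂ)
        = ((-(2 * Real.pi * x) : ℝ) : ℂ) := by
      push_cast
      linear_combination (2 * Real.pi * x : ℂ) * Complex.I_sq
    rw [e, ← Complex.ofReal_exp, Real.exp_neg, boseKernel]
    have h3 : Real.exp (2 * Real.pi * x) - 1 ≠ 0 := by
      rw [sub_ne_zero, Ne, Real.exp_eq_one_iff]
      positivity
    have h0 : Real.exp (2 * Real.pi * x) ≠ 0 := (Real.exp_pos _).ne'
    generalize Real.exp (2 * Real.pi * x) = E at h3 h0 ⊢
    have h3' : (E : ℂ) - 1 ≠ 0 := by exact_mod_cast h3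
    have h0' : (E : ℂ) ≠ 0 := by exact_mod_cast h0
    have h4 : (1 : ℂ) - (E : ℂ)⁻¹ ≠ 0 := by
      have : (1 : ℂ) - (E : ℂ)⁻¹ = (E - 1) / E := by field_simp
      rw [this]; exact div_ne_zero h3' h0'
    push_cast
    field_simp
    ring

lemma integrable_pow_mul_exp_neg_mul_sq {b : ℝ} (hb : 0 < b) (m : ℕ) :
    Integrable (fun x : ℝ => x ^ m * Real.exp (-b * x ^ 2)) := by
  have h := integrable_rpow_mul_exp_neg_mul_sq hb (s := (m : ℝ))
    (by have : (0 : ℝ) ≤ m := m.cast_nonneg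
        linarith)
  simpa [Real.rpow_natCast] using h

lemma integrable_boseKernel_mul_pow {b : ℝ} (hb : 0 < b) (m : ℕ) :
    Integrable (fun x : ℝ => boseKernel x * (x ^ m * Real.exp (-b * x ^ 2))) := by
  have h1 := (integrable_pow_mul_exp_neg_mul_sq hb (m + 1)).norm.add
    (integrable_pow_mul_exp_neg_mul_sq hb m).norm
  refine h1.mono' (measurable_boseKernel.aestronglyMeasurable.mul (by fun_prop)) ?_
  refine Eventually.of_forall fun x => ?_
  simp only [Pi.add_apply, norm_mul, Real.norm_eq_abs, abs_of_nonneg (boseKernel_nonneg x), abs_pow]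
  have := mul_le_mul_of_nonneg_right (boseKernel_le x)
    (by positivity : 0 ≤ |x| ^ m * |Real.exp (-b * x ^ 2)|)
  refine this.trans (le_of_eq ?_)
  ring

/-- Folding the real line: against an even function the kernel acts as `2 x/(e^{2πx} - 1) + x` on
the half-line. -/
lemma integral_boseKernel_mul_even {g : ℝ → ℝ} (hg : ∀ x, g (-x) = g x)
    (hi : Integrable (fun x => boseKernel x * g x)) :
    ∫ x, boseKernel x * g x = ∫ x in Set.Ioi 0, (2 * boseKernel x + x) * g x := by
  have hi' := hi.comp_neg
  rw [← intervalIntegral.integral_Iic_add_Ioi (b := 0) hi.integrableOn hi.integrableOn]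
  have h := integral_comp_neg_Ioi 0 (fun x => boseKernel x * g x)
  rw [neg_zero] at h
  rw [← h, ← integral_add hi'.integrableOn hi.integrableOn]
  refine integral_congr_ae (Eventually.of_forall fun x => ?_)
  simp only [hg, boseKernel_neg]
  ring

/-! ### The functional equation for the plain Gaussian -/

lemma integral_cos_mul_exp_neg_mul_sq {b : ℝ} (hb : 0 < b) (c : ℝ) :
    ∫ x : ℝ, Real.cos (c * x) * Real.exp (-b * x ^ 2)
      = √(Real.pi / b) * Real.exp (-c ^ 2 / (4 * b)) := by
  have hbC : 0 < (b : ℂ).re := by simpa using hb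
  have h := congrArg Complex.re (fourierIntegral_gaussian hbC (c : ℂ))
  have hi : Integrable
      (fun x : ℝ => Complex.exp (Complex.I * c * x) * Complex.exp (-b * x ^ 2)) := by
    refine (integrable_cexp_quadratic hbC (Complex.I * c) 0).congr
      (Eventually.of_forall fun x => ?_)
    simp only
    rw [← Complex.exp_add]
    ring_nf
  have h2 := Complex.reCLM.integral_comp_comm hi
  simp only [Complex.reCLM_apply] at h2
  rw [← h2] at h
  have e1 : ∀ x : ℝ, (Complex.exp (Complex.I * c * x) * Complex.exp (-b * x ^ 2)).re
      = Real.cos (c * x) * Real.exp (-b * x ^ 2) := by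
    intro x
    have : Complex.exp (-b * x ^ 2) = ((Real.exp (-b * x ^ 2) : ℝ) : ℂ) := by push_cast; rfl
    rw [this, Complex.re_mul_ofReal, show (Complex.I * c * x : ℂ) = ((c * x : ℝ) : ℂ) * Complex.I by
      push_cast; ring, Complex.exp_ofReal_mul_I_re]
  simp only [e1] at h
  rw [h]
  have e2 : (Real.pi / b : ℂ) ^ (1 / 2 : ℂ) = ((√(Real.pi / b) : ℝ) : ℂ) := by
    rw [Real.sqrt_eq_rpow, Complex.ofReal_cpow (by positivity)]
    push_cast; rfl
  have e3 : Complex.exp (-(c : ℂ) ^ 2 / (4 * b)) = ((Real.exp (-c ^ 2 / (4 * b)) : ℝ) : ℂ) := by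
    push_cast; rfl
  rw [e2, e3, ← Complex.ofReal_mul, Complex.ofReal_re]

lemma integral_mul_sin_mul_exp_neg_mul_sq {b : ℝ} (hb : 0 < b) (c : ℝ) :
    ∫ x : ℝ, Real.sin (c * x) * (x * Real.exp (-b * x ^ 2))
      = c / (2 * b) * (√(Real.pi / b) * Real.exp (-c ^ 2 / (4 * b))) := by
  have hE := integrable_exp_neg_mul_sq hb
  have hxE := integrable_mul_exp_neg_mul_sq hb
  have key := integral_mul_deriv_eq_deriv_mul_of_integrable
    (u := fun x : ℝ => Real.sin (c * x)) (u' := fun x => Real.cos (c * x) * c)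
    (v := fun x : ℝ => -(1 / (2 * b)) * Real.exp (-b * x ^ 2))
    (v' := fun x => x * Real.exp (-b * x ^ 2))
    (fun x _ => by simpa using ((hasDerivAt_id x).const_mul c).sin)
    (fun x _ => by
      have := (((hasDerivAt_pow 2 x).const_mul (-b)).exp).const_mul (-(1 / (2 * b)))
      convert! this using 1
      field_simp
      simp
      ring)
    (hxE.bdd_mul (c := 1) (by fun_prop)
      (Eventually.of_forall fun x => by simpa using Real.abs_sin_le_one (c * x)))
    ((hE.const_mul (-(1 / (2 * b)))).bdd_mul (c := |c|) (by fun_prop)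
      (Eventually.of_forall fun x => by
        rw [norm_mul, Real.norm_eq_abs, Real.norm_eq_abs]
        exact mul_le_of_le_one_left (abs_nonneg c) (Real.abs_cos_le_one _)))
    ((hE.const_mul (-(1 / (2 * b)))).bdd_mul (c := 1) (by fun_prop)
      (Eventually.of_forall fun x => by simpa using Real.abs_sin_le_one (c * x)))
  rw [key, ← integral_neg, ← integral_cos_mul_exp_neg_mul_sq hb, ← integral_const_mul]
  refine integral_congr_ae (Eventually.of_forall fun x => ?_)
  simp only
  ring

lemma integral_exp_neg_mul_sin_Ioi {b : ℝ} (hb : 0 < b) (c : ℝ) :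
    ∫ y in Set.Ioi (0 : ℝ), Real.exp (-b * y) * Real.sin (c * y) = c / (b ^ 2 + c ^ 2) := by
  have ha : (-b + c * Complex.I : ℂ).re < 0 := by simpa using hb
  have h := congrArg Complex.im (integral_exp_mul_complex_Ioi ha 0)
  have h2 := Complex.imCLM.integral_comp_comm (integrableOn_exp_mul_complex_Ioi ha 0)
  simp only [Complex.imCLM_apply] at h2
  rw [← h2] at h
  have e1 : ∀ y : ℝ, (Complex.exp ((-b + c * Complex.I) * y)).im
      = Real.exp (-b * y) * Real.sin (c * y) := by
    intro y
    rw [Complex.exp_im]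
    simp
  simp only [e1] at h
  rw [h]
  have hn : (-b + c * Complex.I : ℂ) = ⟨-b, c⟩ := by apply Complex.ext <;> simp
  rw [hn]
  simp [Complex.div_im, Complex.normSq_apply]
  ring_nf

/-- The sine transform of `e^{-2πNy}` is a multiple of `x / (x² + N²)`, that of `x e^{-bx²}` is again
of this shape; exchanging the two integrations relates the terms of the two expansions of the
kernel. -/
lemma integral_sq_div_sq_add_sq_mul_exp {b : ℝ} (hb : 0 < b) {N : ℝ} (hN : 0 < N) :
    ∫ x : ℝ, x ^ 2 / (x ^ 2 + N ^ 2) * Real.exp (-b * x ^ 2)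
      = 2 * Real.pi ^ 2 / b * √(Real.pi / b) *
        ∫ y in Set.Ioi (0 : ℝ), y * Real.exp (-(2 * Real.pi * N) * y)
          * Real.exp (-(Real.pi ^ 2 / b) * y ^ 2) := by
  have hpi := Real.pi_pos
  have hA : 0 < 2 * Real.pi * N := by positivity
  set A := 2 * Real.pi * N with hAdef
  have hint : Integrable (Function.uncurry fun x y : ℝ =>
      (x * Real.exp (-b * x ^ 2)) * (Real.exp (-A * y) * Real.sin (2 * Real.pi * x * y)))
      (volume.prod (volume.restrict (Set.Ioi 0))) := by
    have h0 : Integrable (fun y : ℝ => Real.exp (-A * y)) (volume.restrict (Set.Ioi 0)) :=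
      integrableOn_exp_mul_Ioi (by linarith) 0
    have h1 := (integrable_mul_exp_neg_mul_sq hb).mul_prod h0
    refine h1.norm.mono' (by fun_prop) (Eventually.of_forall fun p => ?_)
    simp only [Function.uncurry, norm_mul, Real.norm_eq_abs]
    rw [← mul_assoc]
    exact mul_le_of_le_one_right (by positivity) (Real.abs_sin_le_one _)
  calc ∫ x : ℝ, x ^ 2 / (x ^ 2 + N ^ 2) * Real.exp (-b * x ^ 2)
      = ∫ x : ℝ, 2 * Real.pi * ∫ y in Set.Ioi (0 : ℝ), (x * Real.exp (-b * x ^ 2)) *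
          (Real.exp (-A * y) * Real.sin (2 * Real.pi * x * y)) := by
        refine integral_congr_ae (Eventually.of_forall fun x => ?_)
        simp only
        rw [integral_const_mul, integral_exp_neg_mul_sin_Ioi hA, hAdef]
        have h0 : x ^ 2 + N ^ 2 ≠ 0 := by positivity
        have h1 : (2 * Real.pi * N) ^ 2 + (2 * Real.pi * x) ^ 2
          = 4 * Real.pi ^ 2 * (x ^ 2 + N ^ 2) := by ring
        rw [h1]
        field_simp
        ring
    _ = 2 * Real.pi * ∫ y in Set.Ioi (0 : ℝ), ∫ x : ℝ, (x * Real.exp (-b * x ^ 2)) *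
          (Real.exp (-A * y) * Real.sin (2 * Real.pi * x * y)) := by
        rw [integral_const_mul, integral_integral_swap hint]
    _ = _ := by
        rw [← integral_const_mul, ← integral_const_mul]
        refine integral_congr_ae (Eventually.of_forall fun y => ?_)
        simp only
        have e : ∀ x : ℝ, (x * Real.exp (-b * x ^ 2)) *
            (Real.exp (-A * y) * Real.sin (2 * Real.pi * x * y))
            = Real.exp (-A * y) *
              (Real.sin ((2 * Real.pi * y) * x) * (x * Real.exp (-b * x ^ 2))) := by
          intro x
          rw [show 2 * Real.pi * x * y = (2 * Real.pi * y) * x by ring]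
          ring
        simp only [e]
        rw [integral_const_mul, integral_mul_sin_mul_exp_neg_mul_sq hb]
        rw [show -(2 * Real.pi * y) ^ 2 / (4 * b) = -(Real.pi ^ 2 / b) * y ^ 2 by
          field_simp; ring]
        field_simp

lemma integrable_boseKernel_mul_exp {b : ℝ} (hb : 0 < b) :
    Integrable (fun x : ℝ => boseKernel x * Real.exp (-b * x ^ 2)) := by
  simpa using integrable_boseKernel_mul_pow hb 0

lemma integral_id_mul_exp_Ioi {b : ℝ} (hb : 0 < b) :
    ∫ x in Set.Ioi (0 : ℝ), x * Real.exp (-b * x ^ 2) = 1 / (2 * b) := by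
  have h := integral_mul_cexp_neg_mul_sq (b := (b : ℂ)) (by simpa using hb)
  have e : ∀ x : ℝ, (x : ℂ) * Complex.exp (-b * (x : ℂ) ^ 2)
      = ((x * Real.exp (-b * x ^ 2) : ℝ) : ℂ) := by intro x; push_cast; rfl
  simp only [e] at h
  rw [integral_complex_ofReal] at h
  rw [one_div]
  exact_mod_cast h

/-- Term by term integration against the geometric expansion of the kernel. -/
lemma hasSum_integral_boseKernel_geometric {b : ℝ} (hb : 0 < b) :
    HasSum (fun n : ℕ => ∫ x in Set.Ioi (0 : ℝ), x * Real.exp (-(2 * Real.pi * (n + 1)) * x)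
        * Real.exp (-b * x ^ 2))
      (((∫ x, boseKernel x * Real.exp (-b * x ^ 2)) - 1 / (2 * b)) / 2) := by
  have hi := integrable_boseKernel_mul_exp hb
  have hs : ∀ x ∈ Set.Ioi (0 : ℝ), HasSum (fun n : ℕ =>
      x * Real.exp (-(2 * Real.pi * (n + 1)) * x) * Real.exp (-b * x ^ 2))
      (boseKernel x * Real.exp (-b * x ^ 2)) := fun x hx => (hasSum_boseKernel hx).mul_right _
  have hfold : ∫ x, boseKernel x * Real.exp (-b * x ^ 2)
      = 2 * (∫ x in Set.Ioi 0, boseKernel x * Real.exp (-b * x ^ 2)) + 1 / (2 * b) := by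
    rw [integral_boseKernel_mul_even (g := fun x => Real.exp (-b * x ^ 2)) (by simp) hi,
      ← integral_id_mul_exp_Ioi hb, ← integral_const_mul,
      ← integral_add (hi.integrableOn.const_mul 2) (integrable_mul_exp_neg_mul_sq hb).integrableOn]
    refine integral_congr_ae (Eventually.of_forall fun x => ?_)
    simp only
    ring
  rw [hfold, show (2 * (∫ x in Set.Ioi 0, boseKernel x * Real.exp (-b * x ^ 2)) + 1 / (2 * b)
    - 1 / (2 * b)) / 2 = ∫ x in Set.Ioi 0, boseKernel x * Real.exp (-b * x ^ 2) by ring]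
  -- the terms are nonnegative with an integrable sum, so they serve as their own bounds
  refine hasSum_integral_of_dominated_convergence
    (fun n x => x * Real.exp (-(2 * Real.pi * (n + 1)) * x) * Real.exp (-b * x ^ 2))
    (fun n => by fun_prop) (fun n => ?_) ?_ ?_ ?_
  · refine (ae_restrict_mem measurableSet_Ioi).mono fun x hx => ?_
    have hx' : 0 ≤ x := (Set.mem_Ioi.1 hx).le
    rw [Real.norm_of_nonneg (by positivity)]
  · exact (ae_restrict_mem measurableSet_Ioi).mono fun x hx => (hs x hx).summable
  · refine Integrable.congr hi.integrableOn ?_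
    exact (ae_restrict_mem measurableSet_Ioi).mono fun x hx => (hs x hx).tsum_eq.symm
  · exact (ae_restrict_mem measurableSet_Ioi).mono fun x hx => hs x hx

/-- Term by term integration against the Mittag-Leffler expansion of the kernel. -/
lemma hasSum_integral_boseKernel_mittagLeffler {b : ℝ} (hb : 0 < b) :
    HasSum (fun n : ℕ => ∫ x : ℝ, x ^ 2 / (x ^ 2 + ((n : ℝ) + 1) ^ 2) * Real.exp (-b * x ^ 2))
      (Real.pi * (∫ x, boseKernel x * Real.exp (-b * x ^ 2)) - √(Real.pi / b) / 2) := by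
  have hi := integrable_boseKernel_mul_exp hb
  have hx := integrable_mul_exp_neg_mul_sq hb
  have hE := integrable_exp_neg_mul_sq hb
  have hodd : ∫ x : ℝ, x * Real.exp (-b * x ^ 2) = 0 := by
    have h := integral_neg_eq_self (fun x : ℝ => x * Real.exp (-b * x ^ 2)) volume
    have e : ∀ x : ℝ, -x * Real.exp (-b * (-x) ^ 2) = -(x * Real.exp (-b * x ^ 2)) := by
      intro x; rw [neg_sq]; ring
    simp only [e, integral_neg] at h
    linarith
  have hI : Integrable (fun x => (Real.pi * (x / 2 + boseKernel x) - 1 / 2)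
      * Real.exp (-b * x ^ 2)) := by
    refine (((hx.const_mul (Real.pi / 2)).add (hi.const_mul Real.pi)).sub
      (hE.const_mul (1 / 2))).congr (Eventually.of_forall fun x => ?_)
    simp only [Pi.add_apply, Pi.sub_apply]
    ring
  have hval : Real.pi * (∫ x, boseKernel x * Real.exp (-b * x ^ 2)) - √(Real.pi / b) / 2
      = ∫ x, (Real.pi * (x / 2 + boseKernel x) - 1 / 2) * Real.exp (-b * x ^ 2) := by
    have e : ∀ x, (Real.pi * (x / 2 + boseKernel x) - 1 / 2) * Real.exp (-b * x ^ 2)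
        = Real.pi / 2 * (x * Real.exp (-b * x ^ 2))
          + Real.pi * (boseKernel x * Real.exp (-b * x ^ 2))
          - 1 / 2 * Real.exp (-b * x ^ 2) := fun x => by ring
    simp only [e]
    rw [integral_sub (f := fun x => Real.pi / 2 * (x * Real.exp (-b * x ^ 2))
        + Real.pi * (boseKernel x * Real.exp (-b * x ^ 2)))
      ((hx.const_mul _).add (hi.const_mul _)) (hE.const_mul _),
      integral_add (hx.const_mul _) (hi.const_mul _), integral_const_mul, integral_const_mul,
      integral_const_mul, hodd, integral_gaussian]
    ring
  have hne : ∀ᵐ x : ℝ, x ≠ 0 := by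
    simp [ae_iff]
  have hs : ∀ x : ℝ, x ≠ 0 → HasSum (fun n : ℕ =>
      x ^ 2 / (x ^ 2 + ((n : ℝ) + 1) ^ 2) * Real.exp (-b * x ^ 2))
      ((Real.pi * (x / 2 + boseKernel x) - 1 / 2) * Real.exp (-b * x ^ 2)) :=
    fun x hx => (hasSum_boseKernel_mittagLeffler hx).mul_right _
  rw [hval]
  refine hasSum_integral_of_dominated_convergence
    (fun n x => x ^ 2 / (x ^ 2 + ((n : ℝ) + 1) ^ 2) * Real.exp (-b * x ^ 2))
    (fun n => Measurable.aestronglyMeasurable (by fun_prop)) (fun n => ?_) ?_ ?_ ?_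
  · refine Eventually.of_forall fun x => ?_
    rw [Real.norm_of_nonneg (by positivity)]
  · exact hne.mono fun x hx => (hs x hx).summable
  · exact hI.congr (hne.mono fun x hx => (hs x hx).tsum_eq.symm)
  · exact hne.mono fun x hx => hs x hx

/-- The transformation law in the case of the plain Gaussian. -/
lemma integral_boseKernel_mul_exp_functional {b : ℝ} (hb : 0 < b) :
    ∫ x, boseKernel x * Real.exp (-b * x ^ 2)
      = Real.pi / b * √(Real.pi / b) *
        ∫ x, boseKernel x * Real.exp (-(Real.pi ^ 2 / b) * x ^ 2) := by
  have hpi := Real.pi_pos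
  have h1 := hasSum_integral_boseKernel_mittagLeffler hb
  have h2 := (hasSum_integral_boseKernel_geometric (b := Real.pi ^ 2 / b) (by positivity)).mul_left
    (2 * Real.pi ^ 2 / b * √(Real.pi / b))
  have e : ∀ n : ℕ, ∫ x : ℝ, x ^ 2 / (x ^ 2 + ((n : ℝ) + 1) ^ 2) * Real.exp (-b * x ^ 2)
      = _ := fun n => integral_sq_div_sq_add_sq_mul_exp hb (N := (n : ℝ) + 1) (by positivity)
  simp only [e] at h1
  have h := h1.unique h2
  have hpi' := hpi.ne'
  generalize (∫ x, boseKernel x * Real.exp (-b * x ^ 2)) = F at h ⊢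
  generalize (∫ x, boseKernel x * Real.exp (-(Real.pi ^ 2 / b) * x ^ 2)) = G at h ⊢
  generalize √(Real.pi / b) = s at h ⊢
  field_simp at h ⊢
  refine mul_left_cancel₀ hpi' ?_
  linear_combination h / 2

/-! ### The polynomials `₁F₁(-n; 3/2; X)` -/

/-- The polynomial `₁F₁(-n; 3/2; X)`, a multiple of the Laguerre polynomial `L_n^{(1/2)}`. The
binomial coefficient makes the coefficient formula valid in all degrees. -/
noncomputable def kummerPoly (n : ℕ) : Polynomial ℝ :=
  ∑ m ∈ Finset.range (n + 1),
    Polynomial.monomial m ((-1) ^ m * (n.choose m : ℝ) / (ascPochhammer ℝ m).eval (3 / 2))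

lemma ascPochhammer_eval_three_halves_pos (m : ℕ) :
    0 < (ascPochhammer ℝ m).eval (3 / 2 : ℝ) :=
  ascPochhammer_pos m _ (by norm_num)

lemma coeff_kummerPoly (n m : ℕ) : (kummerPoly n).coeff m
    = (-1) ^ m * (n.choose m : ℝ) / (ascPochhammer ℝ m).eval (3 / 2) := by
  simp only [kummerPoly, Polynomial.finsetSum_coeff, Polynomial.coeff_monomial,
    Finset.sum_ite_eq', Finset.mem_range]
  split_ifs with h
  · rfl
  · rw [Nat.choose_eq_zero_of_lt (by omega)]; simp

lemma ascPochhammer_eval_neg_natCast (n m : ℕ) :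
    (ascPochhammer ℝ m).eval (-(n : ℝ)) = (-1) ^ m * (m.factorial : ℝ) * (n.choose m : ℝ) := by
  rw [ascPochhammer_eval_neg_eq_descPochhammer, descPochhammer_eval_eq_descFactorial,
    Nat.descFactorial_eq_factorial_mul_choose]
  push_cast; ring

lemma kummerF_neg_natCast (n : ℕ) (z : ℝ) :
    kummerF (-(n : ℝ)) (3 / 2) z = (kummerPoly n).eval z := by
  rw [kummerF, tsum_eq_sum (s := Finset.range (n + 1))]
  · rw [kummerPoly, Polynomial.eval_finsetSum]
    refine Finset.sum_congr rfl fun m _ => ?_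
    have := (ascPochhammer_eval_three_halves_pos m).ne'
    have := m.factorial_ne_zero
    rw [ascPochhammer_eval_neg_natCast, Polynomial.eval_monomial]
    field_simp
  · intro m hm
    rw [ascPochhammer_eval_neg_natCast, Nat.choose_eq_zero_of_lt (by simpa using hm)]
    simp

/-- The ladder relation: with `t ↦ t^{3/4} e^{-t/2} P_n(t)` in place of `P_n`, it says that the
Euler operator `t d/dt` maps the `n`-th function to a combination of its two neighbours. -/
lemma kummerPoly_ladder (n : ℕ) :
    Polynomial.C (3 / 4 : ℝ) * kummerPoly n
        + (Polynomial.X * Polynomial.derivative (kummerPoly n)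
          - Polynomial.C (1 / 2 : ℝ) * (Polynomial.X * kummerPoly n))
      = Polynomial.C (((n : ℝ) + 3 / 2) / 2) * kummerPoly (n + 1)
        - Polynomial.C ((n : ℝ) / 2) * kummerPoly (n - 1) := by
  ext m
  rcases m with _ | m
  · simp only [Polynomial.coeff_add, Polynomial.coeff_sub,
      Polynomial.mul_coeff_zero, Polynomial.coeff_X_zero, coeff_kummerPoly]
    simp
    ring
  · have h1 := (ascPochhammer_eval_three_halves_pos m).ne'
    have h2 : (m : ℝ) + 3 / 2 ≠ 0 := by positivity
    simp only [Polynomial.coeff_add, Polynomial.coeff_sub, Polynomial.coeff_C_mul,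
      Polynomial.coeff_X_mul, Polynomial.coeff_derivative, coeff_kummerPoly,
      ascPochhammer_succ_eval, pow_succ]
    have hpascal : ((n + 1).choose (m + 1) : ℝ) = n.choose m + n.choose (m + 1) := by
      exact_mod_cast Nat.choose_succ_succ n m
    have hlow : (n : ℝ) * ((n - 1).choose (m + 1) : ℝ)
        = ((n : ℝ) - (m + 1)) * n.choose (m + 1) := by
      rcases n with _ | n
      · simp
      · have k := Nat.choose_mul_succ_eq n (m + 1)
        rcases le_or_gt (m + 1) (n + 1) with h | h
        · have k' : ((n.choose (m + 1) * (n + 1) : ℕ) : ℝ)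
              = (((n + 1).choose (m + 1) * (n + 1 - (m + 1)) : ℕ) : ℝ) := by exact_mod_cast k
          rw [Nat.cast_mul, Nat.cast_mul, Nat.cast_sub h] at k'
          simp only [Nat.add_sub_cancel]
          push_cast at k' ⊢
          linear_combination k'
        · rw [Nat.choose_eq_zero_of_lt h, Nat.choose_eq_zero_of_lt (by omega)]
          simp
    have hadj : ((m : ℝ) + 1) * n.choose (m + 1) = ((n : ℝ) - m) * n.choose m := by
      have k := Nat.choose_succ_right_eq n m
      rcases le_or_gt m n with h | h
      · have k' : ((n.choose (m + 1) * (m + 1) : ℕ) : ℝ)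
              = ((n.choose m * (n - m) : ℕ) : ℝ) := by exact_mod_cast k
        rw [Nat.cast_mul, Nat.cast_mul, Nat.cast_sub h] at k'
        push_cast at k'
        linear_combination k'
      · rw [Nat.choose_eq_zero_of_lt h, Nat.choose_eq_zero_of_lt (by omega)]
        simp
    rw [hpascal]
    field_simp
    linear_combination -8 * hlow - 8 * hadj

/-! ### The ladder of integrals and the functional equations -/

/-- The functional `Q ↦ ∫ x e^{-αx²} / (e^{2πx} - 1) * Q(2αx²) dx` on polynomials. -/
noncomputable def bosePairing (Q : Polynomial ℝ) (α : ℝ) : ℝ :=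
  ∫ x, boseKernel x * (Real.exp (-α * x ^ 2) * Q.eval (2 * α * x ^ 2))

lemma integrable_exp_mul_eval {α : ℝ} (hα : 0 < α) (Q : Polynomial ℝ) :
    Integrable (fun x => boseKernel x * (Real.exp (-α * x ^ 2) * Q.eval (2 * α * x ^ 2))) := by
  induction Q using Polynomial.induction_on' with
  | add P Q hP hQ =>
    refine (hP.add hQ).congr (Eventually.of_forall fun x => ?_)
    simp only [Pi.add_apply, Polynomial.eval_add]
    ring
  | monomial m a =>
    refine ((integrable_boseKernel_mul_pow hα (2 * m)).const_mul (a * (2 * α) ^ m)).congr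
      (Eventually.of_forall fun x => ?_)
    simp only [Polynomial.eval_monomial]
    ring

lemma bosePairing_add {α : ℝ} (hα : 0 < α) (P Q : Polynomial ℝ) :
    bosePairing (P + Q) α = bosePairing P α + bosePairing Q α := by
  rw [bosePairing, bosePairing, bosePairing,
    ← integral_add (integrable_exp_mul_eval hα P) (integrable_exp_mul_eval hα Q)]
  refine integral_congr_ae (Eventually.of_forall fun x => ?_)
  simp only [Polynomial.eval_add]
  ring

lemma bosePairing_C_mul (c : ℝ) (Q : Polynomial ℝ) (α : ℝ) :
    bosePairing (Polynomial.C c * Q) α = c * bosePairing Q α := by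
  rw [bosePairing, bosePairing, ← integral_const_mul]
  refine integral_congr_ae (Eventually.of_forall fun x => ?_)
  simp only [Polynomial.eval_mul, Polynomial.eval_C]
  ring

lemma bosePairing_sub {α : ℝ} (hα : 0 < α) (P Q : Polynomial ℝ) :
    bosePairing (P - Q) α = bosePairing P α - bosePairing Q α := by
  have h := bosePairing_add hα (P - Q) Q
  rw [sub_add_cancel] at h
  linarith

lemma bosePairing_monomial (m : ℕ) (a α : ℝ) : bosePairing (Polynomial.monomial m a) α
    = a * (2 * α) ^ m * ∫ x, boseKernel x * (x ^ (2 * m) * Real.exp (-α * x ^ 2)) := by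
  rw [bosePairing, ← integral_const_mul]
  refine integral_congr_ae (Eventually.of_forall fun x => ?_)
  simp only [Polynomial.eval_monomial]
  ring

lemma hasDerivAt_integral_boseKernel_mul_pow (m : ℕ) {α : ℝ} (hα : 0 < α) :
    HasDerivAt (fun a => ∫ x, boseKernel x * (x ^ (2 * m) * Real.exp (-a * x ^ 2)))
      (-∫ x, boseKernel x * (x ^ (2 * (m + 1)) * Real.exp (-α * x ^ 2))) α := by
  have h := (hasDerivAt_integral_of_dominated_loc_of_deriv_le (μ := volume)
    (F := fun a x => boseKernel x * (x ^ (2 * m) * Real.exp (-a * x ^ 2)))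
    (F' := fun a x => -(boseKernel x * (x ^ (2 * (m + 1)) * Real.exp (-a * x ^ 2))))
    (bound := fun x => boseKernel x * (x ^ (2 * (m + 1)) * Real.exp (-(α / 2) * x ^ 2)))
    (Ioi_mem_nhds (half_lt_self hα))
    (Eventually.of_forall fun a =>
      measurable_boseKernel.aestronglyMeasurable.mul (by fun_prop))
    (integrable_boseKernel_mul_pow hα _)
    (integrable_boseKernel_mul_pow hα _).neg.aestronglyMeasurable
    (Eventually.of_forall fun x a ha => ?_)
    (integrable_boseKernel_mul_pow (half_pos hα) _)
    (Eventually.of_forall fun x a _ => ?_)).2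
  · rwa [integral_neg] at h
  · have h0 := boseKernel_nonneg x
    have h1 : 0 ≤ x ^ (2 * (m + 1)) := (even_two_mul _).pow_nonneg x
    rw [norm_neg, Real.norm_of_nonneg (by positivity)]
    gcongr
    exact (Set.mem_Ioi.1 ha).le
  · have h1 : HasDerivAt (fun a : ℝ => -a * x ^ 2) (-x ^ 2) a := by
      simpa using (hasDerivAt_id a).neg.mul_const (x ^ 2)
    convert! (h1.exp.const_mul (x ^ (2 * m))).const_mul (boseKernel x) using 1
    ring

lemma hasDerivAt_bosePairing (Q : Polynomial ℝ) {α : ℝ} (hα : 0 < α) :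
    HasDerivAt (bosePairing Q)
      (α⁻¹ * bosePairing (Polynomial.X * Polynomial.derivative Q
        - Polynomial.C (1 / 2 : ℝ) * (Polynomial.X * Q)) α) α := by
  induction Q using Polynomial.induction_on' with
  | add P Q hP hQ =>
    have e : bosePairing (P + Q) =ᶠ[𝓝 α] bosePairing P + bosePairing Q :=
      (eventually_gt_nhds hα).mono fun a ha => bosePairing_add ha P Q
    refine HasDerivAt.congr_of_eventuallyEq ?_ e
    convert! hP.add hQ using 1
    rw [← mul_add, ← bosePairing_add hα]
    congr 2
    rw [Polynomial.derivative_add]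
    ring
  | monomial m a =>
    rw [funext fun α => bosePairing_monomial m a α]
    have h1 : HasDerivAt (fun α : ℝ => a * (2 * α) ^ m)
        (a * (m * (2 * α) ^ (m - 1) * 2)) α := by
      simpa using (((hasDerivAt_id α).const_mul 2).pow m).const_mul a
    convert! h1.mul (hasDerivAt_integral_boseKernel_mul_pow m hα) using 1
    rw [bosePairing_sub hα, bosePairing_C_mul, Polynomial.X_mul_monomial, bosePairing_monomial,
      Polynomial.derivative_monomial]
    rcases m with _ | m
    · simp [bosePairing]
      field_simp
    · rw [Polynomial.X_mul_monomial, Nat.add_sub_cancel, bosePairing_monomial]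
      field_simp
      ring

lemma thetaIntegrand_neg_natCast (n : ℕ) (α x : ℝ) : thetaIntegrand (-(n : ℝ)) α x
    = boseKernel x * (Real.exp (-α * x ^ 2) * (kummerPoly n).eval (2 * α * x ^ 2)) := by
  rw [thetaIntegrand, kummerF_neg_natCast, boseKernel]
  ring

lemma thetaIntegral_neg_natCast (n : ℕ) (α : ℝ) :
    thetaIntegral (-(n : ℝ)) α = α ^ (3 / 4 : ℝ) * bosePairing (kummerPoly n) α := by
  rw [thetaIntegral, bosePairing]
  simp only [thetaIntegrand_neg_natCast]

/-- For `n = 0` the last term vanishes, whatever `n - 1` is read as. -/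
lemma hasDerivAt_thetaIntegral (n : ℕ) {α : ℝ} (hα : 0 < α) :
    HasDerivAt (thetaIntegral (-(n : ℝ)))
      (α⁻¹ * (((n : ℝ) + 3 / 2) / 2 * thetaIntegral (-((n + 1 : ℕ) : ℝ)) α
        - (n : ℝ) / 2 * thetaIntegral (-((n - 1 : ℕ) : ℝ)) α)) α := by
  have h := (Real.hasDerivAt_rpow_const (p := (3 / 4 : ℝ)) (Or.inl hα.ne')).mul
    (hasDerivAt_bosePairing (kummerPoly n) hα)
  rw [funext fun α => thetaIntegral_neg_natCast n α]
  convert! h using 1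
  have hl := congrArg (fun Q => bosePairing Q α) (kummerPoly_ladder n)
  rw [bosePairing_add hα, bosePairing_C_mul, bosePairing_sub hα (Polynomial.C _ * _),
    bosePairing_C_mul (((n : ℝ) + 3 / 2) / 2), bosePairing_C_mul ((n : ℝ) / 2)] at hl
  rw [thetaIntegral_neg_natCast, thetaIntegral_neg_natCast, Real.rpow_sub_one hα.ne']
  generalize bosePairing (Polynomial.X * _ - _) α = Y at hl ⊢
  field_simp
  linear_combination (-16 : ℝ) * hl

lemma thetaIntegral_zero_functional {α : ℝ} (hα : 0 < α) :
    thetaIntegral (-((0 : ℕ) : ℝ)) (Real.pi ^ 2 / α) = thetaIntegral (-((0 : ℕ) : ℝ)) α := by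
  have hpi := Real.pi_pos
  have e : ∀ b, bosePairing (kummerPoly 0) b = ∫ x, boseKernel x * Real.exp (-b * x ^ 2) := by
    intro b
    simp [bosePairing, kummerPoly]
  rw [thetaIntegral_neg_natCast, thetaIntegral_neg_natCast, e, e,
    integral_boseKernel_mul_exp_functional hα, ← mul_assoc]
  congr 1
  have h1 : Real.pi / α * √(Real.pi / α) = (Real.pi / α) ^ (3 / 2 : ℝ) := by
    rw [Real.sqrt_eq_rpow, ← Real.rpow_one_add' (by positivity) (by norm_num)]
    norm_num
  have h2 : Real.pi ^ 2 / α = α * (Real.pi / α) ^ (2 : ℝ) := by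
    rw [Real.rpow_two]; field_simp
  rw [h1, h2, Real.mul_rpow hα.le (by positivity), ← Real.rpow_mul (by positivity)]
  norm_num

/-- Both parities of the functional equation at once. Differentiation changes the sign of the
relation for `n`, and the ladder relation then gives the one for `n + 1`. -/
theorem thetaIntegral_functional (n : ℕ) : ∀ {α : ℝ}, 0 < α →
    thetaIntegral (-(n : ℝ)) (Real.pi ^ 2 / α) = (-1) ^ n * thetaIntegral (-(n : ℝ)) α := by
  induction n using Nat.strong_induction_on with
  | _ n ih =>
    intro α hα
    rcases n with _ | n
    · simpa using thetaIntegral_zero_functional hα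
    have hpi := Real.pi_pos
    have hβ : 0 < Real.pi ^ 2 / α := by positivity
    have hinv : HasDerivAt (fun a : ℝ => Real.pi ^ 2 / a) (-(Real.pi ^ 2 / α ^ 2)) α := by
      have := (hasDerivAt_inv hα.ne').const_mul (Real.pi ^ 2)
      convert! this using 1
      field_simp
    have hd1 := (hasDerivAt_thetaIntegral n hβ).comp α hinv
    have hd2 := (hasDerivAt_thetaIntegral n hα).const_mul ((-1 : ℝ) ^ n)
    have hE : (thetaIntegral (-(n : ℝ)) ∘ fun a : ℝ => Real.pi ^ 2 / a)
        =ᶠ[𝓝 α] fun a => (-1) ^ n * thetaIntegral (-(n : ℝ)) a :=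
      (eventually_gt_nhds hα).mono fun a ha => ih n (Nat.lt_succ_self n) ha
    have h := hd1.unique (hd2.congr_of_eventuallyEq hE)
    -- the factor `n` makes this true for `n = 0` as well, where `n - 1` is truncated
    have hprev : (n : ℝ) * thetaIntegral (-((n - 1 : ℕ) : ℝ)) (Real.pi ^ 2 / α)
        = -((n : ℝ) * ((-1) ^ n * thetaIntegral (-((n - 1 : ℕ) : ℝ)) α)) := by
      rcases n with _ | n
      · simp
      · rw [Nat.add_sub_cancel, ih n (by omega) hα, pow_succ]
        ring
    have hn : (n : ℝ) + 3 / 2 ≠ 0 := by positivity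
    have hc : (Real.pi ^ 2 / α)⁻¹ * (Real.pi ^ 2 / α ^ 2) = α⁻¹ := by field_simp
    have hα' := inv_ne_zero hα.ne'
    refine mul_left_cancel₀ hn (mul_left_cancel₀ hα' ?_)
    rw [pow_succ (-1 : ℝ)]
    linear_combination (-2 : ℝ) * h + (-2 * (((n : ℝ) + 3 / 2) / 2
      * thetaIntegral (-((n + 1 : ℕ) : ℝ)) (Real.pi ^ 2 / α) - (n : ℝ) / 2
      * thetaIntegral (-((n - 1 : ℕ) : ℝ)) (Real.pi ^ 2 / α))) * hc
      + α⁻¹ * hprev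

/-! ### The constant `₂F₁(-2k, 1; 3/2; 2)` -/

/-- Wallis-type integral, the Beta value `B(m + 1, 1/2) / 2`. -/
lemma integral_one_sub_sq_pow (m : ℕ) : ∫ v in (0 : ℝ)..1, (1 - v ^ 2) ^ m
    = (m.factorial : ℝ) / (ascPochhammer ℝ m).eval (3 / 2) := by
  induction m with
  | zero => simp
  | succ m ih =>
    have hd : ∀ v ∈ Set.uIcc (0 : ℝ) 1, HasDerivAt (fun v : ℝ => v * (1 - v ^ 2) ^ (m + 1))
        ((2 * m + 3) * (1 - v ^ 2) ^ (m + 1) - (2 * m + 2) * (1 - v ^ 2) ^ m) v := by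
      intro v _
      have h := (hasDerivAt_id v).mul (((hasDerivAt_pow 2 v).const_sub 1).pow (m + 1))
      convert! h using 1
      simp
      ring
    have h := intervalIntegral.integral_eq_sub_of_hasDerivAt hd
      (Continuous.intervalIntegrable (by fun_prop) _ _)
    rw [intervalIntegral.integral_sub (Continuous.intervalIntegrable (by fun_prop) _ _)
      (Continuous.intervalIntegrable (by fun_prop) _ _), intervalIntegral.integral_const_mul,
      intervalIntegral.integral_const_mul, ih] at h
    simp at h
    have h1 := (ascPochhammer_eval_three_halves_pos m).ne'
    have h2 : (m : ℝ) + 3 / 2 ≠ 0 := by positivity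
    rw [ascPochhammer_succ_eval, Nat.factorial_succ]
    push_cast
    have h3 : (2 * m + 3 : ℝ) ≠ 0 := by positivity
    refine mul_left_cancel₀ h3 ?_
    rw [show (3 / 2 + m : ℝ) = (2 * m + 3) / 2 by ring]
    field_simp at h ⊢
    linarith

lemma nearConst_eq_sum (k : ℕ) : nearConst k = ∑ m ∈ Finset.range (2 * k + 1),
    (-2) ^ m * ((2 * k).choose m : ℝ) * ((m.factorial : ℝ) / (ascPochhammer ℝ m).eval (3 / 2)) := by
  rw [nearConst, ordinaryHypergeometric_eq_tsum,
    show -2 * (k : ℝ) = -((2 * k : ℕ) : ℝ) by push_cast; ring]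
  simp only [ascPochhammer_eval_neg_natCast, ascPochhammer_eval_one]
  rw [tsum_eq_sum (s := Finset.range (2 * k + 1))]
  · refine Finset.sum_congr rfl fun m _ => ?_
    have := m.factorial_ne_zero
    rw [smul_eq_mul, show (-2 : ℝ) = -1 * 2 by norm_num, mul_pow]
    field_simp
  · intro m hm
    rw [Nat.choose_eq_zero_of_lt (by simpa using hm)]
    simp

/-- Euler's integral for the terminating series. -/
lemma nearConst_eq_integral (k : ℕ) :
    nearConst k = ∫ v in (0 : ℝ)..1, (2 * v ^ 2 - 1) ^ (2 * k) := by
  rw [nearConst_eq_sum]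
  have e : ∀ v : ℝ, (2 * v ^ 2 - 1) ^ (2 * k) = ∑ m ∈ Finset.range (2 * k + 1),
      (-2) ^ m * ((2 * k).choose m : ℝ) * (1 - v ^ 2) ^ m := by
    intro v
    rw [show 2 * v ^ 2 - 1 = -2 * (1 - v ^ 2) + 1 by ring, add_pow]
    refine Finset.sum_congr rfl fun m _ => ?_
    rw [mul_pow]; ring
  simp only [e]
  rw [intervalIntegral.integral_finsetSum
    (fun m _ => Continuous.intervalIntegrable (by fun_prop) _ _)]
  refine Finset.sum_congr rfl fun m _ => ?_
  rw [intervalIntegral.integral_const_mul, integral_one_sub_sq_pow]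

lemma nearConst_pos (k : ℕ) : 0 < nearConst k := by
  rw [nearConst_eq_integral]
  refine intervalIntegral.integral_pos one_pos (Continuous.continuousOn (by fun_prop))
    (fun v _ => (even_two_mul k).pow_nonneg _) ⟨0, by simp, ?_⟩
  simp

/-! ### Expansions at zero -/

lemma integral_odd_pow_mul_exp_Ioi {b : ℝ} (hb : 0 < b) (m : ℕ) :
    ∫ x in Set.Ioi (0 : ℝ), x ^ (2 * m + 1) * Real.exp (-b * x ^ 2)
      = (m.factorial : ℝ) / (2 * b ^ (m + 1)) := by
  have h := integral_rpow_mul_exp_neg_mul_rpow (p := 2) (q := ((2 * m + 1 : ℕ) : ℝ)) two_pos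
    (by have : (0 : ℝ) ≤ ((2 * m + 1 : ℕ) : ℝ) := Nat.cast_nonneg _
        linarith) hb
  simp only [Real.rpow_natCast, Real.rpow_two] at h
  rw [h, show (((2 * m + 1 : ℕ) : ℝ) + 1) / 2 = ((m : ℝ) + 1) by push_cast; ring,
    show -(((2 * m + 1 : ℕ) : ℝ) + 1) / 2 = -((m + 1 : ℕ) : ℝ) by push_cast; ring,
    Real.Gamma_nat_eq_factorial, Real.rpow_neg hb.le, Real.rpow_natCast]
  field_simp

lemma integrable_id_mul_exp_mul_eval {α : ℝ} (hα : 0 < α) (Q : Polynomial ℝ) :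
    Integrable (fun x : ℝ => x * (Real.exp (-α * x ^ 2) * Q.eval (2 * α * x ^ 2))) := by
  induction Q using Polynomial.induction_on' with
  | add P Q hP hQ =>
    refine (hP.add hQ).congr (Eventually.of_forall fun x => ?_)
    simp only [Pi.add_apply, Polynomial.eval_add]
    ring
  | monomial m a =>
    refine ((integrable_pow_mul_exp_neg_mul_sq hα (2 * m + 1)).const_mul
      (a * (2 * α) ^ m)).congr (Eventually.of_forall fun x => ?_)
    simp only [Polynomial.eval_monomial]
    ring

/-- The main term of the expansion at `α = 0`. -/
lemma integral_id_mul_exp_mul_kummerPoly (k : ℕ) {α : ℝ} (hα : 0 < α) :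
    ∫ x in Set.Ioi (0 : ℝ), x * (Real.exp (-α * x ^ 2) * (kummerPoly (2 * k)).eval (2 * α * x ^ 2))
      = nearConst k / (2 * α) := by
  have e : ∀ x : ℝ, x * (Real.exp (-α * x ^ 2) * (kummerPoly (2 * k)).eval (2 * α * x ^ 2))
      = ∑ m ∈ Finset.range (2 * k + 1), ((-1) ^ m * ((2 * k).choose m : ℝ)
        / (ascPochhammer ℝ m).eval (3 / 2) * (2 * α) ^ m)
        * (x ^ (2 * m + 1) * Real.exp (-α * x ^ 2)) := by
    intro x
    rw [kummerPoly, Polynomial.eval_finsetSum, Finset.mul_sum, Finset.mul_sum]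
    refine Finset.sum_congr rfl fun m _ => ?_
    rw [Polynomial.eval_monomial]
    ring
  simp only [e]
  rw [integral_finsetSum _ fun m _ =>
    ((integrable_pow_mul_exp_neg_mul_sq hα (2 * m + 1)).const_mul _).integrableOn,
    nearConst_eq_sum, Finset.sum_div]
  refine Finset.sum_congr rfl fun m _ => ?_
  have h1 := (ascPochhammer_eval_three_halves_pos m).ne'
  rw [integral_const_mul, integral_odd_pow_mul_exp_Ioi hα, show (-2 : ℝ) = -1 * 2 by norm_num,
    mul_pow, mul_pow]
  field_simp
  ring

/-- First order Taylor bound, uniform on the half-line. -/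
lemma exists_abs_exp_mul_eval_sub_le (Q : Polynomial ℝ) :
    ∃ C : ℝ, 0 ≤ C ∧ ∀ t : ℝ, 0 ≤ t → |Real.exp (-t) * Q.eval (2 * t) - Q.eval 0| ≤ C * t := by
  induction Q using Polynomial.induction_on' with
  | add P Q hP hQ =>
    obtain ⟨C, hC, h⟩ := hP
    obtain ⟨D, hD, h'⟩ := hQ
    refine ⟨C + D, by positivity, fun t ht => ?_⟩
    rw [Polynomial.eval_add, Polynomial.eval_add, add_mul]
    refine le_trans (le_of_eq ?_) ((abs_add_le _ _).trans (add_le_add (h t ht) (h' t ht)))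
    congr 1
    ring
  | monomial m a =>
    rcases m with _ | m
    · refine ⟨|a|, abs_nonneg a, fun t ht => ?_⟩
      have h1 := Real.add_one_le_exp (-t)
      have h2 : Real.exp (-t) ≤ 1 := Real.exp_le_one_iff.2 (by linarith)
      simp only [Polynomial.eval_monomial, pow_zero, mul_one]
      rw [show Real.exp (-t) * a - a = a * (Real.exp (-t) - 1) by ring, abs_mul]
      refine mul_le_mul_of_nonneg_left ?_ (abs_nonneg a)
      rw [abs_le]
      constructor <;> linarith
    · refine ⟨|a| * 2 ^ (m + 1) * m.factorial, by positivity, fun t ht => ?_⟩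
      have h1 := Real.pow_div_factorial_le_exp t ht m
      rw [div_le_iff₀ (by positivity)] at h1
      have h2 : Real.exp (-t) * t ^ m ≤ m.factorial := by
        calc Real.exp (-t) * t ^ m ≤ Real.exp (-t) * (Real.exp t * m.factorial) := by gcongr
          _ = m.factorial := by rw [← mul_assoc, ← Real.exp_add]; simp
      simp only [Polynomial.eval_monomial, zero_pow (Nat.succ_ne_zero m), mul_zero, sub_zero]
      rw [show Real.exp (-t) * (a * (2 * t) ^ (m + 1))
        = a * (2 ^ (m + 1) * (Real.exp (-t) * t ^ m) * t) by ring, abs_mul,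
        abs_of_nonneg (a := 2 ^ (m + 1) * (Real.exp (-t) * t ^ m) * t) (by positivity)]
      calc |a| * (2 ^ (m + 1) * (Real.exp (-t) * t ^ m) * t)
          ≤ |a| * (2 ^ (m + 1) * m.factorial * t) := by gcongr
        _ = _ := by ring

lemma boseKernel_le_exp {x : ℝ} (hx : 0 ≤ x) : boseKernel x ≤ Real.exp (-x) := by
  have hpi := Real.pi_gt_three
  rcases hx.eq_or_lt with rfl | hx
  · simp [boseKernel]
  have h1 : 1 < Real.exp (2 * Real.pi * x) := Real.one_lt_exp_iff.2 (by positivity)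
  rw [boseKernel, div_le_iff₀ (by linarith), Real.exp_neg]
  have h2 : Real.exp x * (1 + x) ≤ Real.exp (2 * Real.pi * x) := by
    calc Real.exp x * (1 + x) ≤ Real.exp x * Real.exp x := by
          gcongr; linarith [Real.add_one_le_exp x]
      _ = Real.exp (x + x) := (Real.exp_add _ _).symm
      _ ≤ _ := Real.exp_le_exp.2 (by nlinarith)
  have h3 : 1 ≤ Real.exp x := Real.one_le_exp hx.le
  have h4 := Real.exp_pos x
  rw [inv_mul_eq_div, le_div_iff₀ h4]
  nlinarith

lemma integrableOn_boseKernel_mul_pow_Ioi (m : ℕ) :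
    IntegrableOn (fun x => boseKernel x * x ^ m) (Set.Ioi 0) := by
  have h := integrableOn_rpow_mul_exp_neg_mul_rpow (p := 1) (s := (m : ℝ)) (b := 1)
    (by have : (0 : ℝ) ≤ m := m.cast_nonneg
        linarith) one_pos one_pos
  simp only [Real.rpow_natCast, Real.rpow_one] at h
  refine Integrable.mono' h (measurable_boseKernel.mul (by fun_prop)).aestronglyMeasurable ?_
  refine (ae_restrict_mem measurableSet_Ioi).mono fun x hx => ?_
  have hx' : 0 ≤ x := (Set.mem_Ioi.1 hx).le
  rw [Real.norm_of_nonneg (mul_nonneg (boseKernel_nonneg x) (by positivity)), mul_comm]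
  have := boseKernel_le_exp hx'
  rw [neg_one_mul]
  gcongr

/-- The integral is `ζ(2) / (2π)²`. -/
lemma integral_boseKernel_Ioi : ∫ x in Set.Ioi (0 : ℝ), boseKernel x = 1 / 24 := by
  have hpi := Real.pi_pos
  have hi : IntegrableOn boseKernel (Set.Ioi 0) := by
    simpa using integrableOn_boseKernel_mul_pow_Ioi 0
  have hs := hasSum_integral_of_dominated_convergence (μ := volume.restrict (Set.Ioi (0 : ℝ)))
    (F := fun (n : ℕ) x => x * Real.exp (-(2 * Real.pi * (n + 1)) * x)) (f := boseKernel)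
    (fun n x => x * Real.exp (-(2 * Real.pi * (n + 1)) * x)) (fun n => by fun_prop)
    (fun n => (ae_restrict_mem measurableSet_Ioi).mono fun x hx => by
      have hx' : 0 ≤ x := (Set.mem_Ioi.1 hx).le
      rw [Real.norm_of_nonneg (by positivity)])
    ((ae_restrict_mem measurableSet_Ioi).mono fun x hx => (hasSum_boseKernel hx).summable)
    (hi.congr ((ae_restrict_mem measurableSet_Ioi).mono fun x hx =>
      (hasSum_boseKernel hx).tsum_eq.symm))
    ((ae_restrict_mem measurableSet_Ioi).mono fun x hx => hasSum_boseKernel hx)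
  have e : ∀ n : ℕ, ∫ x in Set.Ioi (0 : ℝ), x * Real.exp (-(2 * Real.pi * (n + 1)) * x)
      = 1 / (4 * Real.pi ^ 2) * (1 / ((n + 1 : ℕ) : ℝ) ^ 2) := by
    intro n
    have h := Real.integral_rpow_mul_exp_neg_mul_Ioi (a := 2) (r := 2 * Real.pi * (n + 1)) two_pos
      (by positivity)
    rw [show (2 : ℝ) - 1 = 1 by norm_num, Real.Gamma_two, Real.rpow_two] at h
    simp only [Real.rpow_one] at h
    simp only [neg_mul]
    rw [h]
    push_cast
    field_simp
    norm_num
  simp only [e] at hs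
  have hz := ((hasSum_nat_add_iff' 1).2 hasSum_zeta_two).mul_left (1 / (4 * Real.pi ^ 2))
  rw [hs.unique hz]
  simp
  field_simp
  norm_num

/-- An explicit form of the expansion at `α = 0`, valid for all `α > 0`. -/
lemma exists_abs_thetaIntegral_sub_twoTerms_le (k : ℕ) : ∃ C : ℝ, ∀ α : ℝ, 0 < α →
    |thetaIntegral (-2 * (k : ℝ)) α - twoTerms k α| ≤ C * α ^ (7 / 4 : ℝ) := by
  obtain ⟨C, hC, hb⟩ := exists_abs_exp_mul_eval_sub_le (kummerPoly (2 * k))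
  have h0 : (kummerPoly (2 * k)).eval 0 = 1 := by
    rw [← Polynomial.coeff_zero_eq_eval_zero, coeff_kummerPoly]; simp
  refine ⟨2 * (C * ∫ x in Set.Ioi (0 : ℝ), boseKernel x * x ^ 2), fun α hα => ?_⟩
  set g : ℝ → ℝ := fun x => Real.exp (-α * x ^ 2) * (kummerPoly (2 * k)).eval (2 * α * x ^ 2)
    with hg
  have hi : Integrable (fun x => boseKernel x * g x) := integrable_exp_mul_eval hα _
  have hx : Integrable (fun x : ℝ => x * g x) := integrable_id_mul_exp_mul_eval hα _
  have hB : IntegrableOn boseKernel (Set.Ioi 0) := by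
    simpa using integrableOn_boseKernel_mul_pow_Ioi 0
  have hfold : bosePairing (kummerPoly (2 * k)) α
      = 2 * (∫ x in Set.Ioi 0, boseKernel x * (g x - 1)) + 1 / 12 + nearConst k / (2 * α) := by
    rw [bosePairing, integral_boseKernel_mul_even (g := g) (by simp [hg]) hi,
      ← integral_id_mul_exp_mul_kummerPoly k hα]
    have e1 : ∀ x, (2 * boseKernel x + x) * g x = 2 * (boseKernel x * g x) + x * g x :=
      fun x => by ring
    have e2 : ∀ x, boseKernel x * (g x - 1) = boseKernel x * g x - boseKernel x :=
      fun x => by ring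
    simp only [e1, e2]
    rw [integral_add (hi.integrableOn.const_mul 2) hx.integrableOn, integral_const_mul,
      integral_sub hi.integrableOn hB, integral_boseKernel_Ioi]
    ring
  have hrem : |∫ x in Set.Ioi 0, boseKernel x * (g x - 1)|
      ≤ C * α * ∫ x in Set.Ioi (0 : ℝ), boseKernel x * x ^ 2 := by
    rw [← integral_const_mul, ← Real.norm_eq_abs]
    refine norm_integral_le_of_norm_le ((integrableOn_boseKernel_mul_pow_Ioi 2).const_mul _)
      (Eventually.of_forall fun x => ?_)
    have h := hb (α * x ^ 2) (by positivity)
    rw [h0, show 2 * (α * x ^ 2) = 2 * α * x ^ 2 by ring, ← neg_mul] at h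
    rw [norm_mul, Real.norm_of_nonneg (boseKernel_nonneg x), Real.norm_eq_abs]
    calc boseKernel x * |g x - 1| ≤ boseKernel x * (C * (α * x ^ 2)) :=
          mul_le_mul_of_nonneg_left h (boseKernel_nonneg x)
      _ = _ := by ring
  have hp1 : α ^ (-(1 / 4) : ℝ) = α ^ (3 / 4 : ℝ) / α := by
    rw [← Real.rpow_sub_one hα.ne']; norm_num
  have hp2 : α ^ (7 / 4 : ℝ) = α ^ (3 / 4 : ℝ) * α := by
    rw [← Real.rpow_add_one hα.ne']; norm_num
  have hdiff : thetaIntegral (-2 * (k : ℝ)) α - twoTerms k α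
      = α ^ (3 / 4 : ℝ) * (2 * ∫ x in Set.Ioi 0, boseKernel x * (g x - 1)) := by
    rw [show -2 * (k : ℝ) = -((2 * k : ℕ) : ℝ) by push_cast; ring, thetaIntegral_neg_natCast,
      hfold, twoTerms, hp1]
    field_simp
    ring
  rw [hdiff, abs_mul, abs_mul, abs_of_pos (Real.rpow_pos_of_pos hα _), abs_two, hp2]
  have hpos := Real.rpow_pos_of_pos hα (3 / 4 : ℝ)
  calc _ ≤ α ^ (3 / 4 : ℝ) * (2 * (C * α * ∫ x in Set.Ioi (0 : ℝ), boseKernel x * x ^ 2)) := by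
        gcongr
    _ = _ := by ring

lemma abs_one_add_rpow_quarter_sub_le {u : ℝ} (hu : 0 ≤ u) :
    |(1 + u) ^ (1 / 4 : ℝ) - (1 + u / 4)| ≤ u ^ 2 := by
  set y := (1 + u) ^ (1 / 4 : ℝ) with hy
  have hy1 : 1 ≤ y := Real.one_le_rpow (by linarith) (by norm_num)
  have hy4 : y ^ 4 = 1 + u := by
    rw [hy, ← Real.rpow_natCast, ← Real.rpow_mul (by linarith)]
    norm_num
  obtain ⟨s, hs⟩ : ∃ s, y = 1 + s := ⟨y - 1, by ring⟩
  have hs0 : 0 ≤ s := by linarith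
  -- from `u ≥ 4s` the error `u/4 - s`, which is of order `s²`, is at most `u²`
  have hu' : u = 4 * s + 6 * s ^ 2 + 4 * s ^ 3 + s ^ 4 := by
    rw [hs] at hy4; linear_combination -hy4
  have h3 : 0 ≤ s ^ 3 := by positivity
  have h4 : 0 ≤ s ^ 4 := by positivity
  have hlow : (4 * s + 6 * s ^ 2) ^ 2 ≤ u ^ 2 := by
    gcongr
    linarith
  rw [hs, abs_le]
  constructor <;> nlinarith [sq_nonneg s, sq_nonneg u]

lemma exists_abs_nearApprox_sub_twoTerms_le (k : ℕ) : ∃ C : ℝ, ∀ α : ℝ, 0 < α → α ≤ 1 →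
    |nearApprox k α (Real.pi ^ 2 / α) - twoTerms k α| ≤ C * α ^ (7 / 4 : ℝ) := by
  have hc := nearConst_pos k
  have hpi := Real.pi_pos
  set c := nearConst k with hcdef
  refine ⟨c / 2 * ((2 / (3 * c) + 1 / Real.pi ^ 2) ^ 2 + 1 / (4 * Real.pi ^ 2)),
    fun α hα hα1 => ?_⟩
  set u := 2 / (3 * c) * α + 1 / Real.pi ^ 2 * α ^ 2 with hu
  have hu0 : 0 ≤ u := by positivity
  have hule : u ≤ (2 / (3 * c) + 1 / Real.pi ^ 2) * α := by
    have : α ^ 2 ≤ α := by nlinarith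
    have := mul_le_mul_of_nonneg_left this (by positivity : 0 ≤ 1 / Real.pi ^ 2)
    rw [hu, add_mul]
    linarith
  have hp1 : α ^ (3 / 4 : ℝ) = α ^ (-(1 / 4) : ℝ) * α := by
    rw [← Real.rpow_add_one hα.ne']; norm_num
  have hp2 : α ^ (7 / 4 : ℝ) = α ^ (-(1 / 4) : ℝ) * α ^ 2 := by
    rw [← Real.rpow_natCast, ← Real.rpow_add hα]; norm_num
  have hroot : (1 / α + 1 / (Real.pi ^ 2 / α) + 2 / (3 * c)) ^ (1 / 4 : ℝ)
      = α ^ (-(1 / 4) : ℝ) * (1 + u) ^ (1 / 4 : ℝ) := by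
    rw [Real.rpow_neg hα.le, ← Real.inv_rpow hα.le, ← Real.mul_rpow (by positivity) (by positivity)]
    congr 1
    rw [hu]
    field_simp
    ring
  have hdiff : nearApprox k α (Real.pi ^ 2 / α) - twoTerms k α
      = c / 2 * α ^ (-(1 / 4) : ℝ) * (((1 + u) ^ (1 / 4 : ℝ) - (1 + u / 4))
        + 1 / (4 * Real.pi ^ 2) * α ^ 2) := by
    rw [nearApprox, twoTerms, ← hcdef, hroot, hp1]
    generalize (1 + u) ^ (1 / 4 : ℝ) = r
    rw [hu]
    field_simp
    ring
  have hpos := Real.rpow_pos_of_pos hα (-(1 / 4) : ℝ)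
  rw [hdiff, abs_mul, abs_of_pos (by positivity : 0 < c / 2 * α ^ (-(1 / 4) : ℝ)), hp2]
  have hmain : |((1 + u) ^ (1 / 4 : ℝ) - (1 + u / 4)) + 1 / (4 * Real.pi ^ 2) * α ^ 2|
      ≤ ((2 / (3 * c) + 1 / Real.pi ^ 2) * α) ^ 2 + 1 / (4 * Real.pi ^ 2) * α ^ 2 := by
    refine (abs_add_le _ _).trans (add_le_add ?_ (abs_of_nonneg (by positivity)).le)
    exact (abs_one_add_rpow_quarter_sub_le hu0).trans (by gcongr)
  calc _ ≤ c / 2 * α ^ (-(1 / 4) : ℝ) * (((2 / (3 * c) + 1 / Real.pi ^ 2) * α) ^ 2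
        + 1 / (4 * Real.pi ^ 2) * α ^ 2) := by gcongr
    _ = _ := by ring

lemma isBigO_thetaIntegral_sub_twoTerms (k : ℕ) :
    (fun α : ℝ => thetaIntegral (-2 * (k : ℝ)) α - twoTerms k α)
      =O[𝓝[>] 0] (fun α : ℝ => α ^ (7 / 4 : ℝ)) := by
  obtain ⟨C, hC⟩ := exists_abs_thetaIntegral_sub_twoTerms_le k
  refine IsBigO.of_bound C (eventually_mem_nhdsWithin.mono fun α hα => ?_)
  have hα' : 0 < α := hα
  rw [Real.norm_eq_abs, Real.norm_of_nonneg (by positivity)]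
  exact hC α hα'

lemma isBigO_nearApprox_sub_twoTerms (k : ℕ) :
    (fun α : ℝ => nearApprox k α (Real.pi ^ 2 / α) - twoTerms k α)
      =O[𝓝[>] 0] (fun α : ℝ => α ^ (7 / 4 : ℝ)) := by
  obtain ⟨C, hC⟩ := exists_abs_nearApprox_sub_twoTerms_le k
  refine IsBigO.of_bound C ?_
  filter_upwards [Ioc_mem_nhdsGT (zero_lt_one' ℝ)] with α hα
  have hα' : 0 < α := hα.1
  rw [Real.norm_eq_abs, Real.norm_of_nonneg (by positivity)]
  exact hC α hα' hα.2

/-! ### The functional equations and expansions combined -/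

lemma tendsto_pi_sq_div_atTop : Tendsto (fun α : ℝ => Real.pi ^ 2 / α) atTop (𝓝[>] 0) := by
  refine tendsto_nhdsWithin_iff.2 ⟨tendsto_const_nhds.div_atTop tendsto_id, ?_⟩
  have := Real.pi_pos
  exact (eventually_gt_atTop 0).mono fun α hα => by
    have : 0 < Real.pi ^ 2 / α := by positivity
    exact this

theorem theorem1p9 (k : ℕ) :
    -- all the integrals converge absolutely
    (∀ α : ℝ, 0 < α → Integrable (thetaIntegrand (-2 * (k : ℝ)) α) volume ∧
      Integrable (thetaIntegrand (-2 * (k : ℝ) - 1) α) volume) ∧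
    -- (i)
    (∀ α β : ℝ, 0 < α → 0 < β → α * β = Real.pi ^ 2 →
      thetaIntegral (-2 * (k : ℝ)) α = thetaIntegral (-2 * (k : ℝ)) β) ∧
    -- (ii): with β = π²/α, the integral and the approximating function have the same first two
    -- terms in their asymptotic expansions, both as α → 0+ and as α → ∞
    (0 < nearConst k ∧
      (fun α : ℝ => thetaIntegral (-2 * (k : ℝ)) α - twoTerms k α)
        =O[𝓝[>] 0] (fun α : ℝ => α ^ (7 / 4 : ℝ)) ∧
      (fun α : ℝ => nearApprox k α (Real.pi ^ 2 / α) - twoTerms k α)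
        =O[𝓝[>] 0] (fun α : ℝ => α ^ (7 / 4 : ℝ)) ∧
      (fun α : ℝ => thetaIntegral (-2 * (k : ℝ)) α - twoTerms k (Real.pi ^ 2 / α))
        =O[atTop] (fun α : ℝ => (Real.pi ^ 2 / α) ^ (7 / 4 : ℝ)) ∧
      (fun α : ℝ => nearApprox k α (Real.pi ^ 2 / α) - twoTerms k (Real.pi ^ 2 / α))
        =O[atTop] (fun α : ℝ => (Real.pi ^ 2 / α) ^ (7 / 4 : ℝ))) ∧
    -- (iii)
    (∀ α β : ℝ, 0 < α → 0 < β → α * β = Real.pi ^ 2 →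
      thetaIntegral (-2 * (k : ℝ) - 1) α = -thetaIntegral (-2 * (k : ℝ) - 1) β) ∧
    -- the case α = β = π
    ∫ x : ℝ, x * Real.exp (-Real.pi * x ^ 2) / (Real.exp (2 * Real.pi * x) - 1) *
      kummerF (-2 * (k : ℝ) - 1) (3 / 2) (2 * Real.pi * x ^ 2) = 0 := by

  have heven : -2 * (k : ℝ) = -((2 * k : ℕ) : ℝ) := by push_cast; ring
  have hodd : -2 * (k : ℝ) - 1 = -((2 * k + 1 : ℕ) : ℝ) := by push_cast; ring
  have hβ : ∀ {α β : ℝ}, 0 < α → α * β = Real.pi ^ 2 → β = Real.pi ^ 2 / α :=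
    fun hα h => by rw [← h]; field_simp
  have hint : ∀ (n : ℕ) {α : ℝ}, 0 < α → Integrable (thetaIntegrand (-(n : ℝ)) α) volume :=
    fun n α hα => by
      rw [funext fun x => thetaIntegrand_neg_natCast n α x]
      exact integrable_exp_mul_eval hα _
  have hsymm : ∀ α : ℝ, 0 < α →
      thetaIntegral (-2 * (k : ℝ)) (Real.pi ^ 2 / α) = thetaIntegral (-2 * (k : ℝ)) α := by
    intro α hα
    rw [heven, thetaIntegral_functional _ hα, (even_two_mul k).neg_one_pow, one_mul]
  have hanti : ∀ α β : ℝ, 0 < α → 0 < β → α * β = Real.pi ^ 2 →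
      thetaIntegral (-2 * (k : ℝ) - 1) α = -thetaIntegral (-2 * (k : ℝ) - 1) β := by
    intro α β hα _ h
    rw [hβ hα h, hodd, thetaIntegral_functional _ hα, (odd_two_mul_add_one k).neg_one_pow]
    ring
  refine ⟨fun α hα => ⟨?_, ?_⟩, ?_, ⟨nearConst_pos k, isBigO_thetaIntegral_sub_twoTerms k,
    isBigO_nearApprox_sub_twoTerms k, ?_, ?_⟩, hanti, ?_⟩
  · rw [heven]; exact hint _ hα
  · rw [hodd]; exact hint _ hα
  · intro α β hα _ h
    rw [hβ hα h, hsymm α hα]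
  · refine ((isBigO_thetaIntegral_sub_twoTerms k).comp_tendsto tendsto_pi_sq_div_atTop).congr' ?_
      (EventuallyEq.refl _ _)
    filter_upwards [eventually_gt_atTop 0] with α hα
    simp only [Function.comp_apply, hsymm α hα]
  · refine ((isBigO_nearApprox_sub_twoTerms k).comp_tendsto tendsto_pi_sq_div_atTop).congr' ?_
      (EventuallyEq.refl _ _)
    filter_upwards [eventually_gt_atTop 0] with α hα
    have hpi := Real.pi_pos.ne'
    -- the approximating function is symmetric in its two arguments
    have e : Real.pi ^ 2 / (Real.pi ^ 2 / α) = α := by field_simp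
    simp only [Function.comp_apply, nearApprox, e, add_comm (1 / (Real.pi ^ 2 / α)) (1 / α)]
  · have h := hanti Real.pi Real.pi Real.pi_pos Real.pi_pos (sq _).symm
    have h0 : thetaIntegral (-2 * (k : ℝ) - 1) Real.pi = 0 := by linarith
    exact (mul_eq_zero.1 h0).resolve_left (Real.rpow_pos_of_pos Real.pi_pos _).ne'
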